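/- Let $R$ be a commutative ring and $\mathsf{MOD}_R$ the symmetric monoidal category of $R$-modules. For an $R$-module $V$ let $\mathsf{Sh}(V)=\bigoplus_{n\ge 0}V^{\otimes n}$ with the shuffle product, determined by the unit $1\in V^{\otimes 0}=R$ and $(a\otimes w)\mathbin{\sqcup\!\sqcup}(b\otimes v)=a\otimes(w\mathbin{\sqcup\!\sqcup}(b\otimes v))+b\otimes((a\otimes w)\mathbin{\sqcup\!\sqcup} v)$ for $a,b\in V$. A commutative Rota-Baxter algebra (of weight $0$) is a commutative $R$-algebra $B$ with an $R$-linear $Q:B\to B$ satisfying $Q(a)Q(b)=Q(aQ(b))+Q(Q(a)b)$. The free one on a commutative $R$-algebra $A$ is $\mathsf{RB}(A)=\mathsf{Sh}(A)\otimes A$, with the tensor product multiplication and operator $\mathsf P(w\otimes b)=(w\otimes b)\otimes 1$ ($w\otimes b\in\mathsf{Sh}(A)$ being the word $w$ with $b$ appended); the adjunction has unit $a\mapsto 1\otimes a$ and counit $\omega((b_1\otimes\cdots\otimes b_n)\otimes b)=Q(\cdots Q(Q(b_1)b_2)\cdots b_n)\,b$. Composing with the free commutative algebra adjunction $\mathsf{Sym}\dashv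 U$ gives an adjunction between $\mathsf{MOD}_R$ and commutative Rota-Baxter algebras, hence a monad $\mathsf{T}(M)=\mathsf{RB}(\mathsf{Sym}(M))=\mathsf{Sh}(\mathsf{Sym}(M))\otimes\mathsf{Sym}(M)$ on $\mathsf{MOD}_R$, i.e. a comonad on $\mathsf{MOD}_R^{op}$. Let $\mathsf d:\mathsf{Sym}(M)\to\mathsf{Sym}(M)\otimes M$ be the linear map $a_1\cdots a_n\mapsto\sum_i (a_1\cdots a_{i-1}a_{i+1}\cdots a_n)\otimes a_i$. Then: 1. With the multiplication and unit of the algebras $\mathsf{RB}(\mathsf{Sym}(M))$, $\mathsf T$ is an algebra modality on $\mathsf{MOD}_R$, that is, a coalgebra modality on $\mathsf{MOD}_R^{op}$: the algebra structures are commutative and natural in $M$, and the monad multiplication preserves the algebra multiplication. 2. The map $1\otimes\mathsf d:\mathsf{Sh}(\mathsf{Sym}(M))\otimes\mathsf{Sym}(M)\to\mathsf{Sh}(\mathsf{Sym}(M))\otimes\mathsf{Sym}(M)\otimes M$ is a deriving transformation for this coalgebra modality on $\mathsf{MOD}_R^{op}$: it is natural and satisfies the constant, Leibniz, linear, chain and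 interchange rules. 3. For every commutative $R$-algebra $A$, the counit $\omega=\omega_{\mathsf{RB}(A)}:\mathsf{Sh}(\mathsf{RB}(A))\otimes\mathsf{RB}(A)\to\mathsf{RB}(A)$ satisfies $\omega(x\otimes yz)=\omega(x\otimes y)\,z$ for all $x\in\mathsf{Sh}(\mathsf{RB}(A))$ and $y,z\in\mathsf{RB}(A)$. 4. For every $R$-module $M$, $\omega=\omega_{\mathsf{RB}(\mathsf{Sym}(M))}$ satisfies $(1\otimes\mathsf d)\circ\omega=(\omega\otimes 1_M)\circ(1\otimes(1\otimes\mathsf d))$ as maps $\mathsf{Sh}(\mathsf T(M))\otimes\mathsf T(M)\to\mathsf T(M)\otimes M$. 5. If $R\neq 0$, then the coalgebra modality of 1. is neither monoidal nor additive: there are no $m_\otimes$, $m_K$ making it a monoidal coalgebra modality and no $\nabla$, $u$ making it an additive bialgebra modality. Moreover it has no Seely isomorphisms: the map $\mathsf T(0)\to R$ of $\mathsf{MOD}_R^{op}$ given by the algebra unit $R\to\mathsf T(0)$ is not an isomorphism, and for no modules $M,N$ is the Seely map an isomorphism, i.e. the map $\mathsf T(M)\otimes\mathsf T(N)\to\mathsf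 T(M\oplus N)$, $x\otimes y\mapsto\mathsf T(\iota_0)(x)\cdot\mathsf T(\iota_1)(y)$, of $\mathsf{MOD}_R$. -/

import Mathlib

universe u v w

open TensorProduct

noncomputable section

namespace RotaBaxter

section Word

variable {R : Type u} [CommRing R] {M : Type v} [AddCommGroup M] [Module R M]
  {N : Type w} [AddCommGroup N] [Module R N]

theorem word_induction_left {P : TensorAlgebra R M → Prop} (one : P 1)
    (add : ∀ x y, P x → P y → P (x + y)) (smul : ∀ (r : R) x, P x → P (r • x))
    (cons : ∀ a x, P x → P (TensorAlgebra.ι R a * x)) (x : TensorAlgebra R M) : P x := by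
  suffices h : ∀ y, P y → P (x * y) by simpa using h 1 one
  induction x using TensorAlgebra.induction with
  | algebraMap r => intro y hy; rw [← Algebra.smul_def]; exact smul r y hy
  | ι a => exact fun y hy => cons a y hy
  | mul a b ha hb => intro y hy; rw [mul_assoc]; exact ha _ (hb _ hy)
  | add a b ha hb => intro y hy; rw [add_mul]; exact add _ _ (ha _ hy) (hb _ hy)

theorem word_induction_right {P : TensorAlgebra R M → Prop} (one : P 1)
    (add : ∀ x y, P x → P y → P (x + y)) (smul : ∀ (r : R) x, P x → P (r • x))
    (snoc : ∀ x a, P x → P (x * TensorAlgebra.ι R a)) (x : TensorAlgebra R M) : P x := by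
  suffices h : ∀ y, P y → P (y * x) by simpa using h 1 one
  induction x using TensorAlgebra.induction with
  | algebraMap r =>
    intro y hy; rw [← Algebra.commutes, ← Algebra.smul_def]; exact smul r y hy
  | ι a => exact fun y hy => snoc y a hy
  | mul a b ha hb => intro y hy; rw [← mul_assoc]; exact hb _ (ha _ hy)
  | add a b ha hb => intro y hy; rw [mul_add]; exact add _ _ (ha _ hy) (hb _ hy)

/-- The operator `(x, n) ↦ (a x, s a (x, n))` on pairs. -/
def wordStep (s : M →ₗ[R] (TensorAlgebra R M × N →ₗ[R] N)) :
    M →ₗ[R] Module.End R (TensorAlgebra R M × N) where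
  toFun a := LinearMap.prod
    (LinearMap.mulLeft R (TensorAlgebra.ι R a) ∘ₗ LinearMap.fst R _ _) (s a)
  map_add' a b := by ext <;> simp [add_mul]
  map_smul' r a := by ext <;> simp

/-- The linear map `f` on words determined by `f 1 = c` and `f (a x) = s a (x, f x)` for a
letter `a` and a word `x`. -/
def wordRec (s : M →ₗ[R] (TensorAlgebra R M × N →ₗ[R] N)) (c : N) : TensorAlgebra R M →ₗ[R] N :=
  LinearMap.snd R (TensorAlgebra R M) N ∘ₗ
    LinearMap.applyₗ ((1, c) : TensorAlgebra R M × N) ∘ₗ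
      (TensorAlgebra.lift R (wordStep s)).toLinearMap

@[simp] theorem wordRec_one (s : M →ₗ[R] (TensorAlgebra R M × N →ₗ[R] N)) (c : N) :
    wordRec s c 1 = c := by
  simp [wordRec]

theorem wordStep_fst (s : M →ₗ[R] (TensorAlgebra R M × N →ₗ[R] N)) (x : TensorAlgebra R M)
    (p : TensorAlgebra R M × N) :
    (TensorAlgebra.lift R (wordStep s) x p).1 = x * p.1 := by
  induction x using TensorAlgebra.induction generalizing p with
  | algebraMap r => simp [Algebra.smul_def]
  | ι a => simp [wordStep]
  | mul a b ha hb => simp [ha, hb, mul_assoc]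
  | add a b ha hb => simp [ha, hb, add_mul]

@[simp] theorem wordRec_cons (s : M →ₗ[R] (TensorAlgebra R M × N →ₗ[R] N)) (c : N) (a : M)
    (x : TensorAlgebra R M) :
    wordRec s c (TensorAlgebra.ι R a * x) = s a (x, wordRec s c x) := by
  have h := wordStep_fst s x (1, c)
  simp only [mul_one] at h
  have h2 : TensorAlgebra.lift R (wordStep s) x (1, c) = (x, wordRec s c x) :=
    Prod.ext h (by simp [wordRec])
  rw [← h2]
  simp [wordRec, wordStep]

/-- Deconcatenation: a word is sent to the sum of all its splittings into a prefix and a suffix. -/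
def deconcat : TensorAlgebra R M →ₗ[R] TensorAlgebra R M ⊗[R] TensorAlgebra R M :=
  wordRec (N := TensorAlgebra R M ⊗[R] TensorAlgebra R M)
    { toFun := fun a =>
        (TensorProduct.mk R (TensorAlgebra R M) (TensorAlgebra R M) 1 ∘ₗ
            LinearMap.mulLeft R (TensorAlgebra.ι R a)) ∘ₗ LinearMap.fst R _ _ +
          (LinearMap.mulLeft R (TensorAlgebra.ι R a)).rTensor (TensorAlgebra R M) ∘ₗ
            LinearMap.snd R _ _
      map_add' := fun a b => by
        ext <;> simp [add_mul, TensorProduct.tmul_add, TensorProduct.add_tmul]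
      map_smul' := fun r a => by ext <;> simp [TensorProduct.smul_tmul'] }
    (1 ⊗ₜ 1)

@[simp] theorem deconcat_one : deconcat (1 : TensorAlgebra R M) = 1 ⊗ₜ 1 := by
  simp [deconcat]

@[simp] theorem deconcat_cons (a : M) (x : TensorAlgebra R M) :
    deconcat (TensorAlgebra.ι R a * x) = 1 ⊗ₜ (TensorAlgebra.ι R a * x) +
      (LinearMap.mulLeft R (TensorAlgebra.ι R a)).rTensor (TensorAlgebra R M) (deconcat x) := by
  simp [deconcat]

/-- If `φ` is the operator "shuffle with the word `w`", then `shuffleCons a φ` is the operator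
"shuffle with the word `a w`": it sends `v` to the sum of `v₁ a φ(v₂)` over all splittings
`v = v₁ v₂`. -/
def shuffleCons : M →ₗ[R] Module.End R (Module.End R (TensorAlgebra R M)) where
  toFun a :=
    { toFun := fun φ => LinearMap.mul' R (TensorAlgebra R M) ∘ₗ
        (LinearMap.mulLeft R (TensorAlgebra.ι R a) ∘ₗ φ).lTensor (TensorAlgebra R M) ∘ₗ deconcat
      map_add' := fun φ ψ => by
        simp [LinearMap.comp_add, LinearMap.add_comp, LinearMap.lTensor_add]
      map_smul' := fun r φ => by
        simp [LinearMap.comp_smul, LinearMap.smul_comp, LinearMap.lTensor_smul] }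
  map_add' a b := by
    refine LinearMap.ext fun φ => ?_
    have : LinearMap.mulLeft R (TensorAlgebra.ι R a + TensorAlgebra.ι R b) =
        LinearMap.mulLeft R (TensorAlgebra.ι R a) + LinearMap.mulLeft R (TensorAlgebra.ι R b) := by
      ext x; simp [add_mul]
    simp [this, LinearMap.comp_add, LinearMap.add_comp, LinearMap.lTensor_add]
  map_smul' r a := by
    refine LinearMap.ext fun φ => ?_
    have : LinearMap.mulLeft R (r • TensorAlgebra.ι R a) =
        r • LinearMap.mulLeft R (TensorAlgebra.ι R a) := by
      ext x; simp
    simp [this, LinearMap.comp_smul, LinearMap.smul_comp, LinearMap.lTensor_smul]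

/-- The shuffle product on words. It is characterised by `shuffle_one_left`, `shuffle_one_right`
and the recursion `shuffle_cons_cons`. -/
def shuffle : TensorAlgebra R M →ₗ[R] TensorAlgebra R M →ₗ[R] TensorAlgebra R M :=
  LinearMap.applyₗ (LinearMap.id : Module.End R (TensorAlgebra R M)) ∘ₗ
    (TensorAlgebra.lift R (shuffleCons (R := R) (M := M))).toLinearMap

@[simp] theorem shuffle_one_left (v : TensorAlgebra R M) : shuffle 1 v = v := by
  simp [shuffle]

theorem shuffle_cons (a : M) (w v : TensorAlgebra R M) :
    shuffle (TensorAlgebra.ι R a * w) v = shuffleCons a (shuffle w) v := by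
  simp [shuffle]

@[simp] theorem shuffle_one_right (w : TensorAlgebra R M) : shuffle w 1 = w := by
  induction w using word_induction_left with
  | one => simp
  | add x y hx hy => simp [hx, hy]
  | smul r x hx => simp [hx]
  | cons a x hx => simp [shuffle_cons, shuffleCons, hx]

/-- The defining recursion of the shuffle product:
`(a w) ⧢ (b v) = a (w ⧢ (b v)) + b ((a w) ⧢ v)` for letters `a`, `b`. -/
theorem shuffle_cons_cons (a b : M) (w v : TensorAlgebra R M) :
    shuffle (TensorAlgebra.ι R a * w) (TensorAlgebra.ι R b * v) =
      TensorAlgebra.ι R a * shuffle w (TensorAlgebra.ι R b * v) +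
        TensorAlgebra.ι R b * shuffle (TensorAlgebra.ι R a * w) v := by
  rw [shuffle_cons, shuffle_cons]
  simp only [shuffleCons, LinearMap.coe_mk, AddHom.coe_mk, LinearMap.comp_apply, deconcat_cons,
    map_add, LinearMap.lTensor_tmul, LinearMap.mul'_apply, LinearMap.mulLeft_apply, one_mul]
  congr 1
  induction deconcat v using TensorProduct.induction_on with
  | zero => simp
  | tmul x y => simp [mul_assoc]
  | add x y hx hy => simp [hx, hy, mul_add]

theorem shuffle_comm (w v : TensorAlgebra R M) : shuffle w v = shuffle v w := by
  induction w using word_induction_left generalizing v with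
  | one => simp
  | add x y hx hy => simp [hx, hy]
  | smul r x hx => simp [hx]
  | cons a w hw =>
    induction v using word_induction_left with
    | one => simp
    | add x y hx hy => simp [hx, hy]
    | smul r x hx => simp [hx]
    | cons b v hv => rw [shuffle_cons_cons, shuffle_cons_cons, hw, hv, add_comm]

theorem shuffle_assoc (x y z : TensorAlgebra R M) :
    shuffle (shuffle x y) z = shuffle x (shuffle y z) := by
  induction x using word_induction_left generalizing y z with
  | one => simp
  | add x y hx hy => simp [hx, hy]
  | smul r x hx => simp [hx]
  | cons a x hx =>
    induction y using word_induction_left generalizing z with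
    | one => simp
    | add x y hx hy => simp [hx, hy]
    | smul r x hx => simp [hx]
    | cons b y hy =>
      induction z using word_induction_left with
      | one => simp
      | add x y hx hy => simp only [map_add, hx, hy]
      | smul r x hx => simp only [map_smul, hx]
      | cons c z hz =>
        rw [shuffle_cons_cons a b, shuffle_cons_cons b c]
        simp only [map_add, LinearMap.add_apply]
        rw [shuffle_cons_cons a c, shuffle_cons_cons b c, shuffle_cons_cons a b,
          shuffle_cons_cons a c, hx, hy, ← hz, shuffle_cons_cons a b, shuffle_cons_cons b c]
        simp only [map_add, LinearMap.add_apply, mul_add]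
        abel

theorem shuffle_letter_snoc (a b : M) (v : TensorAlgebra R M) :
    shuffle (TensorAlgebra.ι R a) (v * TensorAlgebra.ι R b) =
      v * TensorAlgebra.ι R b * TensorAlgebra.ι R a +
        shuffle (TensorAlgebra.ι R a) v * TensorAlgebra.ι R b := by
  induction v using word_induction_left with
  | one =>
    have := shuffle_cons_cons a b (1 : TensorAlgebra R M) 1
    simp only [mul_one, shuffle_one_left, shuffle_one_right] at this
    simp [this, add_comm]
  | add x y hx hy => simp only [add_mul, map_add, hx, hy]; abel
  | smul r x hx => simp [hx]
  | cons c v hv =>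
    have h1 := shuffle_cons_cons a c (1 : TensorAlgebra R M) (v * TensorAlgebra.ι R b)
    have h2 := shuffle_cons_cons a c (1 : TensorAlgebra R M) v
    simp only [mul_one, shuffle_one_left] at h1 h2
    rw [mul_assoc, h1, h2, hv]
    simp only [mul_add, add_mul, mul_assoc]
    abel

/-- The shuffle recursion read from the right. -/
theorem shuffle_snoc_snoc (w v : TensorAlgebra R M) (a b : M) :
    shuffle (w * TensorAlgebra.ι R a) (v * TensorAlgebra.ι R b) =
      shuffle w (v * TensorAlgebra.ι R b) * TensorAlgebra.ι R a +
        shuffle (w * TensorAlgebra.ι R a) v * TensorAlgebra.ι R b := by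
  induction w using word_induction_left generalizing v with
  | one => simp [shuffle_letter_snoc]
  | add x y hx hy => simp only [add_mul, map_add, LinearMap.add_apply, hx, hy]; abel
  | smul r x hx => simp [hx]
  | cons c w hw =>
    induction v using word_induction_left with
    | one =>
      simp only [one_mul, shuffle_one_right]
      rw [shuffle_comm, shuffle_letter_snoc, shuffle_comm (TensorAlgebra.ι R b), add_comm]
    | add x y hx hy => simp only [add_mul, map_add, hx, hy]; abel
    | smul r x hx => simp [hx]
    | cons d v hv =>
      rw [mul_assoc, mul_assoc, shuffle_cons_cons, ← mul_assoc _ v, hw, ← mul_assoc _ w,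
        hv, mul_assoc _ w, mul_assoc _ v, shuffle_cons_cons c d, shuffle_cons_cons c d]
      simp only [mul_add, add_mul, mul_assoc]
      abel

end Word

section Algebra

variable (R : Type u) [CommRing R] (M : Type v) [AddCommGroup M] [Module R M]

/-- The shuffle algebra `Sh(M) = ⨁ₙ M^{⊗n}`: the module underlying the tensor algebra, with the
shuffle product as multiplication. -/
def ShuffleAlgebra : Type max u v := TensorAlgebra R M

namespace ShuffleAlgebra

/-- The additive group of the tensor algebra. -/
abbrev addCommGroupOfWords : AddCommGroup (ShuffleAlgebra R M) :=
  inferInstanceAs (AddCommGroup (TensorAlgebra R M))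

variable {R M} in
/-- The shuffle algebra is a commutative ring, with the addition of the tensor algebra. -/
instance : CommRing (ShuffleAlgebra R M) where
  __ := addCommGroupOfWords R M
  mul x y := shuffle (R := R) (M := M) x y
  one := (1 : TensorAlgebra R M)
  mul_assoc x y z := shuffle_assoc (R := R) (M := M) x y z
  mul_comm x y := shuffle_comm (R := R) (M := M) x y
  one_mul x := shuffle_one_left (R := R) (M := M) x
  mul_one x := shuffle_one_right (R := R) (M := M) x
  left_distrib x y z := map_add (shuffle (R := R) (M := M) x) y z
  right_distrib x y z := LinearMap.map_add₂ (shuffle (R := R) (M := M)) x y z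
  zero_mul x := LinearMap.map_zero₂ (shuffle (R := R) (M := M)) x
  mul_zero x := map_zero (shuffle (R := R) (M := M) x)

/-- The `R`-module structure of the tensor algebra. -/
abbrev moduleOfWords : Module R (ShuffleAlgebra R M) :=
  inferInstanceAs (Module R (TensorAlgebra R M))

variable {R M} in
instance : Algebra R (ShuffleAlgebra R M) :=
  letI := moduleOfWords R M
  Algebra.ofModule
    (fun r x y => LinearMap.map_smul₂ (shuffle (R := R) (M := M)) r x y)
    (fun r x y => map_smul (shuffle (R := R) (M := M) x) r y)

/-- The identity map from words to the shuffle algebra. -/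
def ofWord : TensorAlgebra R M ≃ₗ[R] ShuffleAlgebra R M where
  toFun x := x
  invFun x := x
  map_add' _ _ := rfl
  map_smul' _ _ := rfl
  left_inv _ := rfl
  right_inv _ := rfl

variable {R M}

theorem ofWord_one : ofWord R M 1 = 1 := rfl

theorem ofWord_mul_ofWord (x y : TensorAlgebra R M) :
    ofWord R M x * ofWord R M y = ofWord R M (shuffle x y) := rfl

variable (R M) in
/-- The map `w ⊗ a ↦ w a` which appends a letter to a word. -/
def snoc : ShuffleAlgebra R M →ₗ[R] M →ₗ[R] ShuffleAlgebra R M :=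
  LinearMap.mk₂ R
    (fun w a => ofWord R M ((ofWord R M).symm w * TensorAlgebra.ι R a))
    (fun x y a => by simp [add_mul]) (fun r x a => by simp)
    (fun x a b => by simp [mul_add]) (fun r x a => by simp)

theorem snoc_apply (w : TensorAlgebra R M) (a : M) :
    snoc R M (ofWord R M w) a = ofWord R M (w * TensorAlgebra.ι R a) := rfl

theorem snoc_mul_snoc (x y : ShuffleAlgebra R M) (a b : M) :
    snoc R M x a * snoc R M y b = snoc R M (x * snoc R M y b) a + snoc R M (snoc R M x a * y) b :=
  shuffle_snoc_snoc (R := R) (M := M) x y a b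

theorem induction_on {P : ShuffleAlgebra R M → Prop} (one : P 1)
    (add : ∀ x y, P x → P y → P (x + y)) (smul : ∀ (r : R) x, P x → P (r • x))
    (snoc : ∀ x a, P x → P (snoc R M x a)) (x : ShuffleAlgebra R M) : P x :=
  word_induction_right (R := R) (M := M) (P := fun x => P (ofWord R M x)) one add smul snoc x

theorem linearMap_ext {N : Type w} [AddCommGroup N] [Module R N] {f g : ShuffleAlgebra R M →ₗ[R] N}
    (one : f 1 = g 1) (h : ∀ x a, f x = g x → f (snoc R M x a) = g (snoc R M x a)) : f = g := by
  refine LinearMap.ext fun x => ?_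
  induction x using induction_on with
  | one => exact one
  | add x y hx hy => simp [hx, hy]
  | smul r x hx => simp [hx]
  | snoc x a hx => exact h x a hx

/-- A linear map out of `Sh(M)` that is compatible with products of words is an algebra map. -/
def mkAlgHom {B : Type w} [CommRing B] [Algebra R B] (f : ShuffleAlgebra R M →ₗ[R] B)
    (one : f 1 = 1)
    (snoc : ∀ x y a b, f (x * snoc R M y b) = f x * f (snoc R M y b) →
      f (snoc R M x a * y) = f (snoc R M x a) * f y →
      f (snoc R M x a * snoc R M y b) = f (snoc R M x a) * f (snoc R M y b)) :
    ShuffleAlgebra R M →ₐ[R] B :=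
  AlgHom.ofLinearMap f one fun x y => by
    induction x using induction_on generalizing y with
    | one => simp [one]
    | add x y hx hy => simp [hx, hy, add_mul]
    | smul r x hx => simp [hx]
    | snoc x a hx =>
      induction y using induction_on with
      | one => simp [one]
      | add x y hx hy => simp [hx, hy, mul_add]
      | smul r x hx => simp [hx]
      | snoc y b hy => exact snoc x y a b (hx _) hy

/-- Functoriality of words: `b₁ ⋯ bₙ ↦ f(b₁) ⋯ f(bₙ)`. -/
def mapLinear {N : Type w} [AddCommGroup N] [Module R N] (f : M →ₗ[R] N) :
    ShuffleAlgebra R M →ₗ[R] ShuffleAlgebra R N :=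
  ofWord R N ∘ₗ (TensorAlgebra.lift R (TensorAlgebra.ι R ∘ₗ f)).toLinearMap ∘ₗ (ofWord R M).symm

theorem mapLinear_one {N : Type w} [AddCommGroup N] [Module R N] (f : M →ₗ[R] N) :
    mapLinear f 1 = 1 :=
  map_one (TensorAlgebra.lift R (TensorAlgebra.ι R ∘ₗ f))

theorem mapLinear_snoc {N : Type w} [AddCommGroup N] [Module R N] (f : M →ₗ[R] N)
    (x : ShuffleAlgebra R M) (a : M) :
    mapLinear f (snoc R M x a) = snoc R N (mapLinear f x) (f a) := by
  obtain ⟨w, rfl⟩ := (ofWord R M).surjective x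
  rw [snoc_apply]
  simp [mapLinear, snoc_apply]

/-- `Sh(f) : Sh(M) → Sh(N)`. -/
def map {N : Type w} [AddCommGroup N] [Module R N] (f : M →ₗ[R] N) :
    ShuffleAlgebra R M →ₐ[R] ShuffleAlgebra R N :=
  mkAlgHom (mapLinear f) (mapLinear_one f) fun x y a b h1 h2 => by
    rw [snoc_mul_snoc, map_add, mapLinear_snoc, mapLinear_snoc, h1, h2]
    simp only [mapLinear_snoc]
    rw [snoc_mul_snoc]

@[simp] theorem map_snoc {N : Type w} [AddCommGroup N] [Module R N] (f : M →ₗ[R] N)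
    (x : ShuffleAlgebra R M) (a : M) : map f (snoc R M x a) = snoc R N (map f x) (f a) :=
  mapLinear_snoc f x a

theorem algHom_ext {B : Type w} [CommRing B] [Algebra R B] {f g : ShuffleAlgebra R M →ₐ[R] B}
    (h : ∀ x a, f x = g x → f (snoc R M x a) = g (snoc R M x a)) : f = g :=
  AlgHom.toLinearMap_injective (linearMap_ext (by simp) h)

end ShuffleAlgebra

section Free

variable (A : Type v) [CommRing A] [Algebra R A]

/-- The free commutative Rota-Baxter algebra `RB(A) = Sh(A) ⊗ A` on a commutative algebra `A`. -/
abbrev FreeRB : Type max u v := ShuffleAlgebra R A ⊗[R] A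

/-- The Rota-Baxter operator `w ⊗ b ↦ (w b) ⊗ 1` of `RB(A)`; for `w = r ∈ R` the word `w b` is the
one-letter word `r • b`. -/
def FreeRB.P : FreeRB R A →ₗ[R] FreeRB R A :=
  (TensorProduct.mk R (ShuffleAlgebra R A) A).flip 1 ∘ₗ TensorProduct.lift (ShuffleAlgebra.snoc R A)

variable {R A}

@[simp] theorem FreeRB.P_tmul (w : ShuffleAlgebra R A) (b : A) :
    FreeRB.P R A (w ⊗ₜ b) = ShuffleAlgebra.snoc R A w b ⊗ₜ 1 := by
  simp [FreeRB.P]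

theorem FreeRB.rotaBaxter (x y : FreeRB R A) :
    FreeRB.P R A x * FreeRB.P R A y =
      FreeRB.P R A (x * FreeRB.P R A y) + FreeRB.P R A (FreeRB.P R A x * y) := by
  induction x using TensorProduct.induction_on with
  | zero => simp
  | add x y hx hy => simp only [map_add, add_mul, hx, hy]; abel
  | tmul w a =>
    induction y using TensorProduct.induction_on with
    | zero => simp
    | add x y hx hy => simp only [map_add, mul_add, hx, hy]; abel
    | tmul v b =>
      simp [ShuffleAlgebra.snoc_mul_snoc, TensorProduct.add_tmul]

variable {B : Type v} [CommRing B] [Algebra R B] (Q : B →ₗ[R] B)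

/-- The linear map `b₁ ⋯ bₙ ↦ Q(⋯ Q(Q(b₁) b₂) ⋯ bₙ)`, with `1 ↦ 1`. -/
def nestLinear : ShuffleAlgebra R B →ₗ[R] B :=
  LinearMap.applyₗ (1 : B) ∘ₗ (MulOpposite.opLinearEquiv R).symm.toLinearMap ∘ₗ
    (TensorAlgebra.lift R ((MulOpposite.opLinearEquiv R).toLinearMap ∘ₗ
      (LinearMap.compRight R Q ∘ₗ LinearMap.mul R B :
        B →ₗ[R] Module.End R B))).toLinearMap ∘ₗ
      (ShuffleAlgebra.ofWord R B).symm.toLinearMap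

theorem nestLinear_one : nestLinear Q 1 = 1 := by
  rw [← ShuffleAlgebra.ofWord_one]
  simp [nestLinear]

theorem nestLinear_snoc (x : ShuffleAlgebra R B) (b : B) :
    nestLinear Q (ShuffleAlgebra.snoc R B x b) = Q (nestLinear Q x * b) := by
  obtain ⟨w, rfl⟩ := (ShuffleAlgebra.ofWord R B).surjective x
  rw [ShuffleAlgebra.snoc_apply]
  simp [nestLinear, mul_comm]

variable (hQ : ∀ a b, Q a * Q b = Q (a * Q b) + Q (Q a * b))

/-- `nestLinear Q` as an algebra map, for a Rota-Baxter operator `Q`. -/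
def nest : ShuffleAlgebra R B →ₐ[R] B :=
  ShuffleAlgebra.mkAlgHom (nestLinear Q) (nestLinear_one Q) fun x y a b h1 h2 => by
    rw [ShuffleAlgebra.snoc_mul_snoc, map_add, nestLinear_snoc, nestLinear_snoc, h1, h2]
    simp only [nestLinear_snoc]
    rw [hQ, add_comm, add_comm (Q (_ * Q _))]
    congr 2 <;> ring

@[simp] theorem nest_snoc (x : ShuffleAlgebra R B) (b : B) :
    nest Q hQ (ShuffleAlgebra.snoc R B x b) = Q (nest Q hQ x * b) :=
  nestLinear_snoc Q x b

/-- The map `ω : Sh(B) ⊗ B → B`, `(b₁ ⋯ bₙ) ⊗ b ↦ Q(⋯ Q(Q(b₁) b₂) ⋯ bₙ) b`, for a Rota-Baxter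
algebra `(B, Q)`. -/
def counitAlgHom : FreeRB R B →ₐ[R] B :=
  Algebra.TensorProduct.productMap (nest Q hQ) (AlgHom.id R B)

@[simp] theorem counitAlgHom_tmul (w : ShuffleAlgebra R B) (b : B) :
    counitAlgHom Q hQ (w ⊗ₜ b) = nest Q hQ w * b := by
  simp [counitAlgHom]

/-- The explicit formula for `ω` on pure tensors. -/
theorem counitAlgHom_word (l : List B) (b : B) :
    counitAlgHom Q hQ (ShuffleAlgebra.ofWord R B (l.map (TensorAlgebra.ι R)).prod ⊗ₜ b) =
      l.foldl (fun x c => Q (x * c)) 1 * b := by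
  rw [counitAlgHom_tmul]
  congr 1
  induction l using List.reverseRecOn with
  | nil => simp [ShuffleAlgebra.ofWord_one]
  | append_singleton l c ih =>
    rw [List.map_append, List.prod_append, List.foldl_append, ← ih]
    simp [← ShuffleAlgebra.snoc_apply]

end Free

end Algebra
section Sym
variable (R : Type u) [CommRing R] (M : Type v) [AddCommGroup M] [Module R M]

/-- The algebra map `Sym(M) → Sym(M) ⋉ (Sym(M) ⊗ M)` with `m ↦ (m, 1 ⊗ m)`; its second component
is a derivation. -/
def symDerivAux : SymmetricAlgebra R M →ₐ[R]
    TrivSqZeroExt (SymmetricAlgebra R M) (SymmetricAlgebra R M ⊗[R] M) :=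
  SymmetricAlgebra.lift
    ((TrivSqZeroExt.inlAlgHom R (SymmetricAlgebra R M)
        (SymmetricAlgebra R M ⊗[R] M)).toLinearMap ∘ₗ SymmetricAlgebra.ι R M +
      (TrivSqZeroExt.inrHom (SymmetricAlgebra R M)
        (SymmetricAlgebra R M ⊗[R] M)).restrictScalars R ∘ₗ
          TensorProduct.mk R (SymmetricAlgebra R M) M 1)

/-- The deriving transformation of `Sym`, the map
`d : a₁ ⋯ aₙ ↦ ∑ᵢ (a₁ ⋯ aᵢ₋₁ aᵢ₊₁ ⋯ aₙ) ⊗ aᵢ`; see `symDeriv_prod`. -/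
def symDeriv : SymmetricAlgebra R M →ₗ[R] SymmetricAlgebra R M ⊗[R] M :=
  (TrivSqZeroExt.sndHom (SymmetricAlgebra R M)
    (SymmetricAlgebra R M ⊗[R] M)).restrictScalars R ∘ₗ (symDerivAux R M).toLinearMap

variable {R M}

theorem symDerivAux_fst (x : SymmetricAlgebra R M) : (symDerivAux R M x).fst = x := by
  have : (TrivSqZeroExt.fstHom R (SymmetricAlgebra R M) (SymmetricAlgebra R M ⊗[R] M)).comp
      (symDerivAux R M) = AlgHom.id R _ := by
    ext m
    simp [symDerivAux]
  exact congr($this x)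

@[simp] theorem symDeriv_ι (m : M) : symDeriv R M (SymmetricAlgebra.ι R M m) = 1 ⊗ₜ m := by
  simp [symDeriv, symDerivAux]

@[simp] theorem symDeriv_one : symDeriv R M 1 = 0 := by
  simp [symDeriv]

theorem symDeriv_mul (x y : SymmetricAlgebra R M) :
    symDeriv R M (x * y) = x • symDeriv R M y + y • symDeriv R M x := by
  simp [symDeriv, symDerivAux_fst]

/-- The explicit formula for `d` on a product of generators. -/
theorem symDeriv_prod {κ : Type*} [DecidableEq κ] (s : Finset κ) (a : κ → M) :
    symDeriv R M (∏ i ∈ s, SymmetricAlgebra.ι R M (a i)) =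
      ∑ i ∈ s, (∏ j ∈ s.erase i, SymmetricAlgebra.ι R M (a j)) ⊗ₜ[R] a i := by
  induction s using Finset.induction_on with
  | empty => simp
  | insert k s hk ih =>
    rw [Finset.prod_insert hk, symDeriv_mul, ih, Finset.sum_insert hk, Finset.erase_insert hk,
      symDeriv_ι, add_comm]
    congr 1
    · simp [TensorProduct.smul_tmul']
    · rw [Finset.smul_sum]
      refine Finset.sum_congr rfl fun i hi => ?_
      have hik : k ≠ i := fun h => hk (h ▸ hi)
      rw [Finset.erase_insert_of_ne hik, Finset.prod_insert (by simp [hk]),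
        TensorProduct.smul_tmul', smul_eq_mul]
end Sym

section Functoriality

variable {R : Type u} [CommRing R] {A B C : Type u} [CommRing A] [Algebra R A] [CommRing B]
  [Algebra R B] [CommRing C] [Algebra R C]

/-- `RB(f) = Sh(f) ⊗ f`. -/
def FreeRB.map (f : A →ₐ[R] B) : FreeRB R A →ₐ[R] FreeRB R B :=
  Algebra.TensorProduct.map (ShuffleAlgebra.map f.toLinearMap) f

@[simp] theorem FreeRB.map_tmul (f : A →ₐ[R] B) (w : ShuffleAlgebra R A) (a : A) :
    FreeRB.map f (w ⊗ₜ a) = ShuffleAlgebra.map f.toLinearMap w ⊗ₜ f a := by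
  simp [FreeRB.map]

theorem FreeRB.map_P (f : A →ₐ[R] B) (x : FreeRB R A) :
    FreeRB.map f (FreeRB.P R A x) = FreeRB.P R B (FreeRB.map f x) := by
  induction x using TensorProduct.induction_on with
  | zero => simp
  | add x y hx hy => simp only [map_add, hx, hy]
  | tmul w a => simp

theorem FreeRB.map_id : FreeRB.map (AlgHom.id R A) = AlgHom.id R (FreeRB R A) := by
  have h : ShuffleAlgebra.map (AlgHom.id R A).toLinearMap = AlgHom.id R _ :=
    ShuffleAlgebra.algHom_ext fun x a h => by rw [ShuffleAlgebra.map_snoc, h]; rfl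
  rw [FreeRB.map, h, Algebra.TensorProduct.map_id]

theorem FreeRB.map_comp (f : A →ₐ[R] B) (g : B →ₐ[R] C) :
    FreeRB.map (g.comp f) = (FreeRB.map g).comp (FreeRB.map f) := by
  have h : ShuffleAlgebra.map (g.comp f).toLinearMap =
      (ShuffleAlgebra.map g.toLinearMap).comp (ShuffleAlgebra.map f.toLinearMap) :=
    ShuffleAlgebra.algHom_ext fun x a h => by
      rw [ShuffleAlgebra.map_snoc, h]; simp
  rw [FreeRB.map, h, Algebra.TensorProduct.map_comp, FreeRB.map, FreeRB.map]

theorem counitAlgHom_P (Q : B →ₗ[R] B) (hQ : ∀ a b, Q a * Q b = Q (a * Q b) + Q (Q a * b))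
    (x : FreeRB R B) : counitAlgHom Q hQ (FreeRB.P R B x) = Q (counitAlgHom Q hQ x) := by
  induction x using TensorProduct.induction_on with
  | zero => simp
  | add x y hx hy => simp only [map_add, hx, hy]
  | tmul w a => simp

theorem counitAlgHom_naturality (P : A →ₗ[R] A)
    (hP : ∀ a b, P a * P b = P (a * P b) + P (P a * b)) (Q : B →ₗ[R] B)
    (hQ : ∀ a b, Q a * Q b = Q (a * Q b) + Q (Q a * b)) (f : A →ₐ[R] B)
    (hf : ∀ a, f (P a) = Q (f a)) :
    (counitAlgHom Q hQ).comp (FreeRB.map f) = f.comp (counitAlgHom P hP) := by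
  refine Algebra.TensorProduct.ext (ShuffleAlgebra.algHom_ext fun x a h => ?_)
    (AlgHom.ext fun a => ?_)
  · simp only [AlgHom.comp_apply, Algebra.TensorProduct.includeLeft_apply, FreeRB.map_tmul,
      counitAlgHom_tmul, map_one, mul_one, ShuffleAlgebra.map_snoc, nest_snoc] at h ⊢
    rw [h, hf]
    simp
  · simp

theorem counitAlgHom_unit (Q : B →ₗ[R] B) (hQ : ∀ a b, Q a * Q b = Q (a * Q b) + Q (Q a * b))
    (b : B) : counitAlgHom Q hQ (1 ⊗ₜ b) = b := by
  simp

theorem lift_id_naturality (f : A →ₐ[R] B) (a : A) :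
    SymmetricAlgebra.lift (LinearMap.id : B →ₗ[R] B)
      (SymmetricAlgebra.lift (SymmetricAlgebra.ι R B ∘ₗ f.toLinearMap)
        (SymmetricAlgebra.ι R A a)) =
      f (SymmetricAlgebra.lift (LinearMap.id : A →ₗ[R] A) (SymmetricAlgebra.ι R A a)) := by
  simp

theorem counitAlgHom_map_unit :
    (counitAlgHom (FreeRB.P R A) FreeRB.rotaBaxter).comp
      (FreeRB.map (Algebra.TensorProduct.includeRight : A →ₐ[R] FreeRB R A)) =
      AlgHom.id R (FreeRB R A) := by
  refine Algebra.TensorProduct.ext (ShuffleAlgebra.algHom_ext fun x a h => ?_)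
    (AlgHom.ext fun a => ?_)
  · simp only [AlgHom.comp_apply, Algebra.TensorProduct.includeLeft_apply, FreeRB.map_tmul,
      counitAlgHom_tmul, map_one, mul_one, ShuffleAlgebra.map_snoc, nest_snoc] at h ⊢
    rw [h]
    simp
  · simp

end Functoriality

section Categories

open CategoryTheory

variable (R : Type u) [CommRing R]

/-- A commutative Rota-Baxter algebra of weight `0` over `R`. -/
structure CRBA where
  /-- The underlying commutative algebra. -/
  alg : CommAlgCat.{u} R
  /-- The Rota-Baxter operator. -/
  P : alg →ₗ[R] alg
  rotaBaxter : ∀ a b, P a * P b = P (a * P b) + P (P a * b)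

variable {R} in
/-- A map of Rota-Baxter algebras: an algebra map commuting with the operators. -/
@[ext]
structure CRBA.Hom (X Y : CRBA.{u} R) where
  /-- The underlying algebra map. -/
  hom : X.alg ⟶ Y.alg
  map_P : ∀ a, hom.hom (X.P a) = Y.P (hom.hom a)

/-- The category `CRBA_R` of commutative Rota-Baxter algebras. -/
instance : Category (CRBA.{u} R) where
  Hom X Y := CRBA.Hom X Y
  id X := ⟨𝟙 _, fun a => rfl⟩
  comp f g := ⟨f.hom ≫ g.hom, fun a => by simp [f.map_P, g.map_P]⟩

variable {R} in
@[ext] theorem CRBA.hom_ext {X Y : CRBA.{u} R} {f g : X ⟶ Y} (h : f.hom = g.hom) : f = g :=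
  CRBA.Hom.ext h

/-- The forgetful functor `CRBA_R ⥤ CALG_R`. -/
@[simps] def forgetRB : CRBA.{u} R ⥤ CommAlgCat.{u} R where
  obj X := X.alg
  map f := f.hom

/-- The forgetful functor `CALG_R ⥤ MOD_R`. -/
@[simps] def forgetAlg : CommAlgCat.{u} R ⥤ ModuleCat.{u} R where
  obj A := ModuleCat.of R A
  map f := ModuleCat.ofHom f.hom.toLinearMap

/-- The free commutative algebra functor `Sym : MOD_R ⥤ CALG_R`. -/
@[simps] def symFunctor : ModuleCat.{u} R ⥤ CommAlgCat.{u} R where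
  obj M := CommAlgCat.of R (SymmetricAlgebra R M)
  map f := CommAlgCat.ofHom (SymmetricAlgebra.lift (SymmetricAlgebra.ι R _ ∘ₗ f.hom))
  map_id M := by
    ext : 1
    refine SymmetricAlgebra.algHom_ext (LinearMap.ext fun m => ?_)
    simp
  map_comp f g := by
    ext : 1
    refine SymmetricAlgebra.algHom_ext (LinearMap.ext fun m => ?_)
    simp

/-- The adjunction `Sym ⊣ U` between `MOD_R` and `CALG_R`, with unit `η = ι : M → Sym(M)` and
counit `ε : Sym(A) → A`, `a₁ ⋯ aₙ ↦ a₁ ⋯ aₙ`. -/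
def symAdj : symFunctor R ⊣ forgetAlg R :=
  Adjunction.mkOfUnitCounit
    { unit :=
        { app := fun M => ModuleCat.ofHom (SymmetricAlgebra.ι R M)
          naturality := fun M N f => by
            refine ModuleCat.hom_ext (LinearMap.ext fun m => ?_)
            exact (SymmetricAlgebra.lift_ι_apply (SymmetricAlgebra.ι R N ∘ₗ f.hom) m).symm }
      counit :=
        { app := fun A => CommAlgCat.ofHom (SymmetricAlgebra.lift (LinearMap.id : A →ₗ[R] A))
          naturality := fun A B f => by
            refine CommAlgCat.hom_ext (SymmetricAlgebra.algHom_ext (LinearMap.ext fun m => ?_))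
            exact lift_id_naturality f.hom m }
      left_triangle := by
        ext M : 2
        refine CommAlgCat.hom_ext (SymmetricAlgebra.algHom_ext (LinearMap.ext fun m => ?_))
        change SymmetricAlgebra.lift (LinearMap.id : SymmetricAlgebra R M →ₗ[R] _)
          (SymmetricAlgebra.lift (SymmetricAlgebra.ι R (SymmetricAlgebra R M) ∘ₗ
            SymmetricAlgebra.ι R M) (SymmetricAlgebra.ι R M m)) = SymmetricAlgebra.ι R M m
        simp
      right_triangle := by
        ext A : 2
        refine ModuleCat.hom_ext (LinearMap.ext fun m => ?_)
        exact SymmetricAlgebra.lift_ι_apply (LinearMap.id : A →ₗ[R] A) m }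

/-- The free Rota-Baxter algebra functor `RB : CALG_R ⥤ CRBA_R`, `RB(A) = Sh(A) ⊗ A`. -/
def rbFunctor : CommAlgCat.{u} R ⥤ CRBA.{u} R where
  obj A := ⟨CommAlgCat.of R (FreeRB R A), FreeRB.P R A, FreeRB.rotaBaxter⟩
  map f := ⟨CommAlgCat.ofHom (FreeRB.map f.hom), FreeRB.map_P f.hom⟩
  map_id _ := CRBA.hom_ext (CommAlgCat.hom_ext FreeRB.map_id)
  map_comp f g := CRBA.hom_ext (CommAlgCat.hom_ext (FreeRB.map_comp f.hom g.hom))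

/-- The adjunction `RB ⊣ U` between `CALG_R` and `CRBA_R`, with unit `v ⊗ 1 : a ↦ 1 ⊗ a` and counit
`ω : Sh(B) ⊗ B → B`. -/
def rbAdj : rbFunctor R ⊣ forgetRB R :=
  Adjunction.mkOfUnitCounit
    { unit :=
        { app := fun A => CommAlgCat.ofHom
            (Algebra.TensorProduct.includeRight : A →ₐ[R] FreeRB R A)
          naturality := fun A B f => CommAlgCat.hom_ext (AlgHom.ext fun a => by
            change (1 : ShuffleAlgebra R B) ⊗ₜ[R] f.hom a =
              FreeRB.map f.hom ((1 : ShuffleAlgebra R A) ⊗ₜ[R] a)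
            simp) }
      counit :=
        { app := fun B => ⟨CommAlgCat.ofHom (counitAlgHom B.P B.rotaBaxter),
            counitAlgHom_P B.P B.rotaBaxter⟩
          naturality := fun A B f => CRBA.hom_ext (CommAlgCat.hom_ext
            (counitAlgHom_naturality A.P A.rotaBaxter B.P B.rotaBaxter f.hom.hom f.map_P)) }
      left_triangle := by
        ext A : 2
        exact CRBA.hom_ext (CommAlgCat.hom_ext counitAlgHom_map_unit)
      right_triangle := by
        ext B : 2
        refine CommAlgCat.hom_ext (AlgHom.ext fun b => ?_)
        exact counitAlgHom_unit B.P B.rotaBaxter b }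

/-- The composite adjunction between `MOD_R` and `CRBA_R`. -/
def rbSymAdj : symFunctor R ⋙ rbFunctor R ⊣ forgetRB R ⋙ forgetAlg R :=
  (symAdj R).comp (rbAdj R)

end Categories

section DifferentialCategories

open CategoryTheory MonoidalCategory Limits

universe v₁ u₁

variable {C : Type u₁} [Category.{v₁} C] [MonoidalCategory C] [SymmetricCategory C]

/-- `(!, δ, ε, Δ, e)` is a coalgebra modality: each `!A` is naturally a cocommutative comonoid and
`δ` preserves the comultiplication. -/
structure IsCoalgebraModality (G : Comonad C) (Δ : ∀ A : C, G.obj A ⟶ G.obj A ⊗ G.obj A)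
    (e : ∀ A : C, G.obj A ⟶ 𝟙_ C) : Prop where
  comul_natural : ∀ {A B : C} (f : A ⟶ B), G.map f ≫ Δ B = Δ A ≫ (G.map f ⊗ₘ G.map f)
  counit_natural : ∀ {A B : C} (f : A ⟶ B), G.map f ≫ e B = e A
  coassoc : ∀ A : C, Δ A ≫ Δ A ▷ G.obj A ≫ (α_ _ _ _).hom = Δ A ≫ G.obj A ◁ Δ A
  counit_left : ∀ A : C, Δ A ≫ e A ▷ G.obj A ≫ (λ_ _).hom = 𝟙 (G.obj A)
  counit_right : ∀ A : C, Δ A ≫ G.obj A ◁ e A ≫ (ρ_ _).hom = 𝟙 (G.obj A)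
  cocomm : ∀ A : C, Δ A ≫ (β_ (G.obj A) (G.obj A)).hom = Δ A
  comul_delta : ∀ A : C, G.δ.app A ≫ Δ (G.obj A) = Δ A ≫ (G.δ.app A ⊗ₘ G.δ.app A)

/-- `d : !A ⊗ A ⟶ !A` is a deriving transformation for the coalgebra modality
`(!, δ, ε, Δ, e)` on an additive symmetric monoidal category (here: enriched in abelian groups). -/
structure IsDerivingTransformation [Preadditive C] [MonoidalPreadditive C] (G : Comonad C)
    (Δ : ∀ A : C, G.obj A ⟶ G.obj A ⊗ G.obj A) (e : ∀ A : C, G.obj A ⟶ 𝟙_ C)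
    (d : ∀ A : C, G.obj A ⊗ A ⟶ G.obj A) : Prop where
  natural : ∀ {A B : C} (f : A ⟶ B), (G.map f ⊗ₘ f) ≫ d B = d A ≫ G.map f
  constant_rule : ∀ A : C, d A ≫ e A = 0
  leibniz_rule : ∀ A : C, d A ≫ Δ A = Δ A ▷ A ≫ (α_ _ _ _).hom ≫
    (G.obj A ◁ d A + G.obj A ◁ (β_ (G.obj A) A).hom ≫ (α_ _ _ _).inv ≫ d A ▷ G.obj A)
  linear_rule : ∀ A : C, d A ≫ G.ε.app A = e A ▷ A ≫ (λ_ A).hom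
  chain_rule : ∀ A : C, d A ≫ G.δ.app A =
    Δ A ▷ A ≫ (α_ _ _ _).hom ≫ (G.δ.app A ⊗ₘ d A) ≫ d (G.obj A)
  interchange_rule : ∀ A : C, d A ▷ A ≫ d A =
    (α_ _ _ _).hom ≫ G.obj A ◁ (β_ A A).hom ≫ (α_ _ _ _).inv ≫ d A ▷ A ≫ d A

/-- `(!, δ, ε, m_⊗, m_K, Δ, e)` is a monoidal coalgebra modality: a coalgebra modality
`(!, δ, ε, Δ, e)` and a symmetric monoidal comonad `(!, δ, ε, m_⊗, m_K)` such that `Δ` and `e` are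
monoidal transformations and `!`-coalgebra morphisms. -/
structure IsMonoidalCoalgebraModality (G : Comonad C)
    (Δ : ∀ A : C, G.obj A ⟶ G.obj A ⊗ G.obj A) (e : ∀ A : C, G.obj A ⟶ 𝟙_ C)
    (m : ∀ A B : C, G.obj A ⊗ G.obj B ⟶ G.obj (A ⊗ B)) (mK : 𝟙_ C ⟶ G.obj (𝟙_ C)) : Prop
    extends IsCoalgebraModality G Δ e where
  m_natural : ∀ {A A' B B' : C} (f : A ⟶ A') (g : B ⟶ B'),
    (G.map f ⊗ₘ G.map g) ≫ m A' B' = m A B ≫ G.map (f ⊗ₘ g)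
  m_assoc : ∀ A B D : C, m A B ▷ G.obj D ≫ m (A ⊗ B) D ≫ G.map (α_ A B D).hom =
    (α_ _ _ _).hom ≫ G.obj A ◁ m B D ≫ m A (B ⊗ D)
  m_unit_left : ∀ A : C, mK ▷ G.obj A ≫ m (𝟙_ C) A ≫ G.map (λ_ A).hom = (λ_ (G.obj A)).hom
  m_unit_right : ∀ A : C, G.obj A ◁ mK ≫ m A (𝟙_ C) ≫ G.map (ρ_ A).hom = (ρ_ (G.obj A)).hom
  m_symm : ∀ A B : C, (β_ (G.obj A) (G.obj B)).hom ≫ m B A = m A B ≫ G.map (β_ A B).hom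
  m_delta : ∀ A B : C, m A B ≫ G.δ.app (A ⊗ B) =
    (G.δ.app A ⊗ₘ G.δ.app B) ≫ m (G.obj A) (G.obj B) ≫ G.map (m A B)
  mK_delta : mK ≫ G.δ.app (𝟙_ C) = mK ≫ G.map mK
  m_epsilon : ∀ A B : C, m A B ≫ G.ε.app (A ⊗ B) = (G.ε.app A ⊗ₘ G.ε.app B)
  mK_epsilon : mK ≫ G.ε.app (𝟙_ C) = 𝟙 (𝟙_ C)
  m_comul : ∀ A B : C, m A B ≫ Δ (A ⊗ B) =
    (Δ A ⊗ₘ Δ B) ≫ tensorμ (G.obj A) (G.obj A) (G.obj B) (G.obj B) ≫ (m A B ⊗ₘ m A B)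
  m_counit : ∀ A B : C, m A B ≫ e (A ⊗ B) = (e A ⊗ₘ e B) ≫ (λ_ (𝟙_ C)).hom
  mK_comul : mK ≫ Δ (𝟙_ C) = (λ_ (𝟙_ C)).inv ≫ (mK ⊗ₘ mK)
  mK_counit : mK ≫ e (𝟙_ C) = 𝟙 (𝟙_ C)
  comul_coalg : ∀ A : C, G.δ.app A ≫ G.map (Δ A) =
    Δ A ≫ (G.δ.app A ⊗ₘ G.δ.app A) ≫ m (G.obj A) (G.obj A)
  counit_coalg : ∀ A : C, G.δ.app A ≫ G.map (e A) = e A ≫ mK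

/-- `(!, δ, ε, Δ, e, ∇, u)` is a bialgebra modality: a coalgebra modality together with a natural
commutative monoid structure on each `!A` making it a bialgebra, with `ε` compatible with `∇`. -/
structure IsBialgebraModality [Preadditive C] [MonoidalPreadditive C] (G : Comonad C)
    (Δ : ∀ A : C, G.obj A ⟶ G.obj A ⊗ G.obj A) (e : ∀ A : C, G.obj A ⟶ 𝟙_ C)
    (mul : ∀ A : C, G.obj A ⊗ G.obj A ⟶ G.obj A) (u : ∀ A : C, 𝟙_ C ⟶ G.obj A) : Prop
    extends IsCoalgebraModality G Δ e where
  mul_natural : ∀ {A B : C} (f : A ⟶ B), (G.map f ⊗ₘ G.map f) ≫ mul B = mul A ≫ G.map f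
  unit_natural : ∀ {A B : C} (f : A ⟶ B), u A ≫ G.map f = u B
  mul_assoc : ∀ A : C, mul A ▷ G.obj A ≫ mul A = (α_ _ _ _).hom ≫ G.obj A ◁ mul A ≫ mul A
  one_mul : ∀ A : C, u A ▷ G.obj A ≫ mul A = (λ_ (G.obj A)).hom
  mul_one : ∀ A : C, G.obj A ◁ u A ≫ mul A = (ρ_ (G.obj A)).hom
  mul_comm : ∀ A : C, (β_ (G.obj A) (G.obj A)).hom ≫ mul A = mul A
  mul_counit : ∀ A : C, mul A ≫ e A = (e A ⊗ₘ e A) ≫ (λ_ (𝟙_ C)).hom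
  unit_comul : ∀ A : C, u A ≫ Δ A = (λ_ (𝟙_ C)).inv ≫ (u A ⊗ₘ u A)
  unit_counit : ∀ A : C, u A ≫ e A = 𝟙 (𝟙_ C)
  mul_comul : ∀ A : C, mul A ≫ Δ A =
    (Δ A ⊗ₘ Δ A) ≫ tensorμ (G.obj A) (G.obj A) (G.obj A) (G.obj A) ≫ (mul A ⊗ₘ mul A)
  mul_epsilon : ∀ A : C, mul A ≫ G.ε.app A =
    (G.ε.app A ⊗ₘ e A) ≫ (ρ_ A).hom + (e A ⊗ₘ G.ε.app A) ≫ (λ_ A).hom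

/-- A bialgebra modality is additive if it turns sums of maps into convolution and zero maps into
the convolution unit. -/
structure IsAdditiveBialgebraModality [Preadditive C] [MonoidalPreadditive C] (G : Comonad C)
    (Δ : ∀ A : C, G.obj A ⟶ G.obj A ⊗ G.obj A) (e : ∀ A : C, G.obj A ⟶ 𝟙_ C)
    (mul : ∀ A : C, G.obj A ⊗ G.obj A ⟶ G.obj A) (u : ∀ A : C, 𝟙_ C ⟶ G.obj A) : Prop
    extends IsBialgebraModality G Δ e mul u where
  map_add : ∀ {A B : C} (f g : A ⟶ B), G.map (f + g) = Δ A ≫ (G.map f ⊗ₘ G.map g) ≫ mul B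
  map_zero : ∀ A B : C, G.map (0 : A ⟶ B) = e A ≫ u B

/-- The Seely map `χ : !(A × B) ⟶ !A ⊗ !B`; the nullary one is `e : !T ⟶ K` at the terminal
object `T`. -/
def seelyMap [HasFiniteProducts C] (G : Comonad C)
    (Δ : ∀ A : C, G.obj A ⟶ G.obj A ⊗ G.obj A) (A B : C) :
    G.obj (A ⨯ B) ⟶ G.obj A ⊗ G.obj B :=
  Δ (A ⨯ B) ≫ (G.map prod.fst ⊗ₘ G.map prod.snd)

/-- The opposite of a symmetric monoidal category is symmetric monoidal. -/
instance opSymmetricCategory : SymmetricCategory Cᵒᵖ where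
  symmetry X Y := Quiver.Hom.unop_inj (SymmetricCategory.symmetry X.unop Y.unop)

/-- The opposite of an additive symmetric monoidal category is additive symmetric monoidal. -/
instance opMonoidalPreadditive [Preadditive C] [MonoidalPreadditive C] :
    MonoidalPreadditive Cᵒᵖ where
  whiskerLeft_zero := Quiver.Hom.unop_inj (MonoidalPreadditive.whiskerLeft_zero)
  zero_whiskerRight := Quiver.Hom.unop_inj (MonoidalPreadditive.zero_whiskerRight)
  whiskerLeft_add f g := Quiver.Hom.unop_inj (MonoidalPreadditive.whiskerLeft_add f.unop g.unop)
  add_whiskerRight f g := Quiver.Hom.unop_inj (MonoidalPreadditive.add_whiskerRight f.unop g.unop)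

end DifferentialCategories

section Modality

open CategoryTheory MonoidalCategory Opposite

variable (R : Type u) [CommRing R]

/-- The comonad on `MOD_Rᵒᵖ` given by the monad `M ↦ RB(Sym(M)) = Sh(Sym(M)) ⊗ Sym(M)` on `MOD_R`
that the composite adjunction induces. -/
def rbComonad : Comonad (ModuleCat.{u} R)ᵒᵖ := (rbSymAdj R).op.toComonad

/-- The multiplication of the algebra `RB(Sym(M))`, as a map in `MOD_Rᵒᵖ`. -/
def rbComul (A : (ModuleCat.{u} R)ᵒᵖ) :
    (rbComonad R).obj A ⟶ (rbComonad R).obj A ⊗ (rbComonad R).obj A :=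
  (ModuleCat.ofHom (LinearMap.mul' R (FreeRB R (SymmetricAlgebra R A.unop)))).op

/-- The unit of the algebra `RB(Sym(M))`, as a map in `MOD_Rᵒᵖ`. -/
def rbCounit (A : (ModuleCat.{u} R)ᵒᵖ) : (rbComonad R).obj A ⟶ 𝟙_ (ModuleCat.{u} R)ᵒᵖ :=
  (ModuleCat.ofHom (Algebra.linearMap R (FreeRB R (SymmetricAlgebra R A.unop)))).op

/-- The map `1 ⊗ d : Sh(Sym(M)) ⊗ Sym(M) → Sh(Sym(M)) ⊗ Sym(M) ⊗ M`. -/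
def rbDeriv (M : Type u) [AddCommGroup M] [Module R M] :
    FreeRB R (SymmetricAlgebra R M) →ₗ[R] FreeRB R (SymmetricAlgebra R M) ⊗[R] M :=
  (TensorProduct.assoc R (ShuffleAlgebra R (SymmetricAlgebra R M))
    (SymmetricAlgebra R M) M).symm.toLinearMap ∘ₗ
    (symDeriv R M).lTensor (ShuffleAlgebra R (SymmetricAlgebra R M))

/-- The map `1 ⊗ d` as a map in `MOD_Rᵒᵖ`. -/
def rbDerivOp (A : (ModuleCat.{u} R)ᵒᵖ) : (rbComonad R).obj A ⊗ A ⟶ (rbComonad R).obj A :=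
  (ModuleCat.ofHom (rbDeriv R A.unop)).op

/-- The counit `ω` of the free Rota-Baxter adjunction at the Rota-Baxter algebra `RB(A)`. -/
def omega (A : Type u) [CommRing A] [Algebra R A] :
    ShuffleAlgebra R (FreeRB R A) ⊗[R] FreeRB R A →ₗ[R] FreeRB R A :=
  (counitAlgHom (FreeRB.P R A) FreeRB.rotaBaxter).toLinearMap

end Modality

end RotaBaxter

end

open CategoryTheory MonoidalCategory TensorProduct RotaBaxter

/-! Write `T(M)` for `RB(Sym(M))` and `D` for `1 ⊗ d`. Since `T(f)`, the monad multiplication and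
`ω` are all algebra maps, the coalgebra modality axioms, read back in `MOD_R`, are the ring axioms
and multiplicativity of these maps.

For the differential part, `D` is a derivation of `T(M)` (`rbDeriv_mul`) that kills `w ⊗ 1` for
every word `w` and sends a generator `m` to `1 ⊗ m`. Since `T(M)` is generated by words and
generators, derivations along a common algebra map are determined by these two kinds of elements
(`FreeRBSym.derivation_ext`). Naturality and the chain rule become checks there. The decisive point
is that nested Rota-Baxter expressions are constants for `D` (`rbDeriv_nest`), because `P` takes
values in `Sh ⊗ 1`. The same fact gives the compatibility of `D` with `ω`. Interchange is symmetry
of second derivatives, a property closed under products.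

The negative results all come from the element `P(1)`, the one-letter word `1`. Maps of Rota-Baxter
algebras preserve it, so `T(0)` does too, yet it is not a scalar when `R` is nontrivial
(`unitLetter_ne_algebraMap`). A monoidal or additive structure would force it to be one. It also
lies outside the image of the unit, and it has the two preimages `P(1) ⊗ 1` and `1 ⊗ P(1)` under the
Seely map. -/

namespace RotaBaxter

/-! ### The derivation on the free Rota-Baxter algebra: Leibniz, naturality, chain rule -/

section Linear

variable (R : Type u) [CommRing R]

/-- The underlying module of the free Rota-Baxter algebra `RB(Sym(M))`. -/
abbrev FreeRBSym (M : Type u) [AddCommGroup M] [Module R M] : Type u :=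
  FreeRB R (SymmetricAlgebra R M)

variable {R}
variable {M N : Type u} [AddCommGroup M] [Module R M] [AddCommGroup N] [Module R N]

/-- `RB(Sym(f))`. -/
noncomputable def rbSymMap (f : M →ₗ[R] N) : FreeRBSym R M →ₐ[R] FreeRBSym R N :=
  FreeRB.map (SymmetricAlgebra.lift (SymmetricAlgebra.ι R N ∘ₗ f))

variable (R M) in
/-- The multiplication of the monad `M ↦ RB(Sym(M))`. -/
noncomputable def rbSymJoin : FreeRBSym R (FreeRBSym R M) →ₐ[R] FreeRBSym R M :=
  (counitAlgHom (FreeRB.P R (SymmetricAlgebra R M)) FreeRB.rotaBaxter).comp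
    (FreeRB.map (SymmetricAlgebra.lift (LinearMap.id : FreeRBSym R M →ₗ[R] FreeRBSym R M)))

variable (R M) in
/-- The unit of the monad `M ↦ RB(Sym(M))`. -/
noncomputable def rbSymUnit : M →ₗ[R] FreeRBSym R M :=
  (Algebra.TensorProduct.includeRight : SymmetricAlgebra R M →ₐ[R] FreeRBSym R M).toLinearMap ∘ₗ
    SymmetricAlgebra.ι R M

/-- Two derivations along an algebra map `φ` out of `RB(Sym(M))` agree if they vanish on words and
agree on generators. -/
theorem FreeRBSym.derivation_ext {B X : Type u} [CommRing B] [Algebra R B] [AddCommGroup X]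
    [Module R X] [Module B X] [IsScalarTower R B X] (φ : FreeRBSym R M →ₐ[R] B)
    {F G : FreeRBSym R M →ₗ[R] X} (hF : ∀ x y, F (x * y) = φ x • F y + φ y • F x)
    (hG : ∀ x y, G (x * y) = φ x • G y + φ y • G x)
    (hword : ∀ w : ShuffleAlgebra R (SymmetricAlgebra R M), F (w ⊗ₜ 1) = G (w ⊗ₜ 1))
    (hι : ∀ m, F (rbSymUnit R M m) = G (rbSymUnit R M m)) : F = G := by
  refine TensorProduct.ext' fun w s => ?_
  have hs : F (1 ⊗ₜ s) = G (1 ⊗ₜ s) := by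
    induction s using SymmetricAlgebra.induction with
    | algebraMap r =>
      -- Scalars are covered by the hypothesis on words, applied to the empty word.
      rw [Algebra.algebraMap_eq_smul_one, tmul_smul, map_smul, map_smul, hword]
    | ι m => exact hι m
    | mul a b ha hb =>
      have : (1 : ShuffleAlgebra R (SymmetricAlgebra R M)) ⊗ₜ[R] (a * b) =
          1 ⊗ₜ a * 1 ⊗ₜ b := by simp
      rw [this, hF, hG, ha, hb]
    | add a b ha hb => rw [tmul_add, map_add, map_add, ha, hb]
  have : w ⊗ₜ[R] s = w ⊗ₜ 1 * 1 ⊗ₜ s := by simp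
  rw [this, hF, hG, hs, hword]

theorem rbDeriv_word (w : ShuffleAlgebra R (SymmetricAlgebra R M)) :
    rbDeriv R M (w ⊗ₜ 1) = 0 := by
  simp [rbDeriv]

theorem rbDeriv_one : rbDeriv R M 1 = 0 := rbDeriv_word 1

theorem rbDeriv_unit (m : M) : rbDeriv R M (rbSymUnit R M m) = 1 ⊗ₜ m := by
  simp [rbDeriv, rbSymUnit, Algebra.TensorProduct.one_def]

theorem tmul_smul_assoc_symm (w v : ShuffleAlgebra R (SymmetricAlgebra R M))
    (s : SymmetricAlgebra R M) (t : SymmetricAlgebra R M ⊗[R] M) :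
    (w ⊗ₜ[R] s) • (TensorProduct.assoc R _ _ M).symm (v ⊗ₜ t) =
      (TensorProduct.assoc R _ _ M).symm ((w * v) ⊗ₜ[R] (s • t)) := by
  induction t using TensorProduct.induction_on with
  | zero => simp
  | add x y hx hy => simp only [tmul_add, map_add, smul_add, hx, hy]
  | tmul a m => simp [TensorProduct.smul_tmul']

/-- `1 ⊗ d` is a derivation. -/
theorem rbDeriv_mul (x y : FreeRBSym R M) :
    rbDeriv R M (x * y) = x • rbDeriv R M y + y • rbDeriv R M x := by
  induction x using TensorProduct.induction_on with
  | zero => simp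
  | add x z hx hz => simp only [add_mul, map_add, add_smul, smul_add, hx, hz]; abel
  | tmul w s =>
    induction y using TensorProduct.induction_on with
    | zero => simp
    | add y z hy hz => simp only [mul_add, map_add, add_smul, smul_add, hy, hz]; abel
    | tmul v t =>
      simp only [rbDeriv, LinearMap.comp_apply, Algebra.TensorProduct.tmul_mul_tmul,
        LinearMap.lTensor_tmul, LinearEquiv.coe_coe]
      rw [tmul_smul_assoc_symm, tmul_smul_assoc_symm, symDeriv_mul, tmul_add, map_add, mul_comm v w]

/-- On a word with at least one letter the outermost operation is `P`, whose values lie in `Sh ⊗ 1`,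
and the derivation vanishes there. So words over `T(M)` evaluate to constants. -/
theorem rbDeriv_nest (w : ShuffleAlgebra R (FreeRBSym R M)) :
    rbDeriv R M (nest (FreeRB.P R (SymmetricAlgebra R M)) FreeRB.rotaBaxter w) = 0 := by
  induction w using ShuffleAlgebra.induction_on with
  | one => rw [map_one, rbDeriv_one]
  | add x y hx hy => rw [map_add, map_add, hx, hy, add_zero]
  | smul r x hx => rw [map_smul, map_smul, hx, smul_zero]
  | snoc x a hx => rw [nest_snoc]; exact rbDeriv_word _

/-- The word is transformed letter by letter under `Sym(f)`, while the second tensor factor stays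
`1`. -/
theorem rbSymMap_word (f : M →ₗ[R] N) (w : ShuffleAlgebra R (SymmetricAlgebra R M)) :
    ∃ v, rbSymMap f (w ⊗ₜ 1) = v ⊗ₜ 1 := by
  exact ⟨_, by simp [rbSymMap]; rfl⟩

theorem rbSymMap_unit (f : M →ₗ[R] N) (m : M) :
    rbSymMap f (rbSymUnit R M m) = rbSymUnit R N (f m) := by
  simp [rbSymMap, rbSymUnit]

/-- The new word is obtained by multiplying out each letter, a formal product of elements of `T(M)`.
The second tensor factor `1` then contributes nothing to `ω`, so only the nested part survives. -/
theorem rbSymJoin_word (w : ShuffleAlgebra R (SymmetricAlgebra R (FreeRBSym R M))) :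
    ∃ v, rbSymJoin R M (w ⊗ₜ 1) =
      nest (FreeRB.P R (SymmetricAlgebra R M)) FreeRB.rotaBaxter v :=
  ⟨_, by simp [rbSymJoin]; rfl⟩

theorem rbSymJoin_unit (x : FreeRBSym R M) : rbSymJoin R M (rbSymUnit R _ x) = x := by
  simp [rbSymJoin, rbSymUnit]

theorem map_smul_tmul {A B : Type u} [CommRing A] [Algebra R A] [CommRing B] [Algebra R B]
    (φ : A →ₐ[R] B) (f : M →ₗ[R] N) (a : A) (z : A ⊗[R] M) :
    TensorProduct.map φ.toLinearMap f (a • z) = φ a • TensorProduct.map φ.toLinearMap f z := by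
  induction z using TensorProduct.induction_on with
  | zero => simp
  | add x y hx hy => simp only [map_add, smul_add, hx, hy]
  | tmul b m => simp [TensorProduct.smul_tmul']

/-- Both composites are derivations along `rbSymMap f`. They vanish on words and send a generator
`m` to `1 ⊗ f m`. -/
theorem rbDeriv_natural (f : M →ₗ[R] N) :
    rbDeriv R N ∘ₗ (rbSymMap f).toLinearMap =
      TensorProduct.map (rbSymMap f).toLinearMap f ∘ₗ rbDeriv R M := by
  refine FreeRBSym.derivation_ext (rbSymMap f) (fun x y => ?_) (fun x y => ?_) (fun w => ?_)
    (fun m => ?_)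
  · simp [rbDeriv_mul]
  · simp [rbDeriv_mul, map_smul_tmul]
  · obtain ⟨v, hv⟩ := rbSymMap_word f w
    simp [hv, rbDeriv_word]
  · simp [rbSymMap_unit, rbDeriv_unit]

/-- The action `a ⊗ z ↦ a z` of an algebra `A` on `A ⊗ M`. -/
noncomputable def tensorAct (A M : Type u) [CommRing A] [Algebra R A] [AddCommGroup M]
    [Module R M] : A ⊗[R] (A ⊗[R] M) →ₗ[R] A ⊗[R] M :=
  (LinearMap.mul' R A).rTensor M ∘ₗ (TensorProduct.assoc R A A M).symm.toLinearMap

theorem tensorAct_tmul {A : Type u} [CommRing A] [Algebra R A] (a : A) (z : A ⊗[R] M) :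
    tensorAct A M (a ⊗ₜ[R] z) = a • z := by
  induction z using TensorProduct.induction_on with
  | zero => simp
  | add x y hx hy => simp only [map_add, smul_add, tmul_add, hx, hy]
  | tmul b m => simp [TensorProduct.smul_tmul', tensorAct]

/-- Both sides are derivations along the monad multiplication. On words both are zero, the left one
by `rbDeriv_nest`; on the generator given by `x` in `T(M)` both give the derivative of `x`. -/
theorem rbDeriv_chain :
    rbDeriv R M ∘ₗ (rbSymJoin R M).toLinearMap =
      tensorAct (FreeRBSym R M) M ∘ₗ
        TensorProduct.map (rbSymJoin R M).toLinearMap (rbDeriv R M) ∘ₗ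
          rbDeriv R (FreeRBSym R M) := by
  refine FreeRBSym.derivation_ext (rbSymJoin R M) (fun x y => ?_) (fun x y => ?_) (fun w => ?_)
    (fun m => ?_)
  · simp [rbDeriv_mul]
  -- The map following the derivation on the right is semilinear along `rbSymJoin`, so the composite
  -- is again a derivation along it.
  · have h (a : FreeRBSym R (FreeRBSym R M)) (z : FreeRBSym R (FreeRBSym R M) ⊗[R] FreeRBSym R M) :
        tensorAct (FreeRBSym R M) M
          (TensorProduct.map (rbSymJoin R M).toLinearMap (rbDeriv R M) (a • z)) =
        rbSymJoin R M a • tensorAct (FreeRBSym R M) M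
          (TensorProduct.map (rbSymJoin R M).toLinearMap (rbDeriv R M) z) := by
      induction z using TensorProduct.induction_on with
      | zero => simp
      | add x y hx hy => simp only [map_add, smul_add, hx, hy]
      | tmul b m => simp [TensorProduct.smul_tmul', tensorAct_tmul, mul_smul]
    simp [rbDeriv_mul, h]
  · obtain ⟨v, hv⟩ := rbSymJoin_word w
    simp [hv, rbDeriv_word, rbDeriv_nest]
  · simp [rbSymJoin_unit, rbDeriv_unit, tensorAct_tmul]

end Linear

/-! ### Symmetry of second derivatives -/

section Interchange

variable {R : Type u} [CommRing R] {M A : Type u} [AddCommGroup M] [Module R M] [CommRing A]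
  [Algebra R A]

/-- The product `(s ⊗ m, t ⊗ n) ↦ (s t ⊗ m) ⊗ n`. -/
noncomputable def tensorPairing (u : A ⊗[R] M) : A ⊗[R] M →ₗ[R] (A ⊗[R] M) ⊗[R] M :=
  ((LinearMap.toSpanSingleton A (A ⊗[R] M) u).restrictScalars R).rTensor M

/-- Swapping the two copies of `M` exchanges the roles of the arguments, since the coefficients in
`A` commute. -/
theorem rightComm_tensorPairing (u z : A ⊗[R] M) :
    TensorProduct.rightComm R A M M (tensorPairing u z) = tensorPairing z u := by
  induction z using TensorProduct.induction_on with
  | zero =>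
    induction u using TensorProduct.induction_on with
    | zero => simp
    | add x y hx hy => rw [map_add, ← hx, ← hy]; simp
    | tmul a m => simp [tensorPairing]
  | add x y hx hy =>
    rw [map_add, map_add, hx, hy]
    simp [tensorPairing, LinearMap.toSpanSingleton_add, LinearMap.restrictScalars_add,
      LinearMap.rTensor_add]
  | tmul b n =>
    induction u using TensorProduct.induction_on with
    | zero => simp [tensorPairing]
    | add x y hx hy =>
      rw [map_add, ← hx, ← hy, ← map_add]
      simp [tensorPairing, LinearMap.toSpanSingleton_add, LinearMap.restrictScalars_add,
        LinearMap.rTensor_add]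
    | tmul a m => simp [tensorPairing, TensorProduct.smul_tmul', mul_comm]

theorem rightComm_smul (a : A) (z : (A ⊗[R] M) ⊗[R] M) :
    TensorProduct.rightComm R A M M (a • z) = a • TensorProduct.rightComm R A M M z := by
  induction z using TensorProduct.induction_on with
  | zero => simp
  | add x y hx hy => simp only [map_add, smul_add, hx, hy]
  | tmul u n =>
    induction u using TensorProduct.induction_on with
    | zero => simp
    | add x y hx hy => simp only [add_tmul, map_add, smul_add, hx, hy]
    | tmul b m => simp [TensorProduct.smul_tmul']

/-- A Leibniz rule for the second application of `D`: the factor `x` is differentiated once, which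
produces the mixed term `tensorPairing (D x) z`. -/
theorem derivation_rTensor_smul {D : A →ₗ[R] A ⊗[R] M}
    (hD : ∀ x y, D (x * y) = x • D y + y • D x) (x : A) (z : A ⊗[R] M) :
    D.rTensor M (x • z) = x • D.rTensor M z + tensorPairing (D x) z := by
  induction z using TensorProduct.induction_on with
  | zero => simp
  | add y z hy hz => simp only [map_add, smul_add, hy, hz]; abel
  | tmul b n => simp [TensorProduct.smul_tmul', hD, tensorPairing, add_tmul]

/-- The elements at which second derivatives are symmetric are closed under products. -/
theorem rightComm_derivation_mul {D : A →ₗ[R] A ⊗[R] M}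
    (hD : ∀ x y, D (x * y) = x • D y + y • D x) {x y : A}
    (hx : TensorProduct.rightComm R A M M (D.rTensor M (D x)) = D.rTensor M (D x))
    (hy : TensorProduct.rightComm R A M M (D.rTensor M (D y)) = D.rTensor M (D y)) :
    TensorProduct.rightComm R A M M (D.rTensor M (D (x * y))) = D.rTensor M (D (x * y)) := by
  -- The second derivative of `x y` consists of `x` times that of `y`, `y` times that of `x`, and
  -- two mixed terms. The swap fixes the first two by hypothesis and interchanges the mixed ones.
  rw [hD, map_add, derivation_rTensor_smul hD, derivation_rTensor_smul hD]
  simp only [map_add, rightComm_smul, rightComm_tensorPairing, hx, hy]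
  abel

theorem rbDeriv_interchange (x : FreeRBSym R M) :
    TensorProduct.rightComm R _ M M ((rbDeriv R M).rTensor M (rbDeriv R M x)) =
      (rbDeriv R M).rTensor M (rbDeriv R M x) := by
  induction x using TensorProduct.induction_on with
  | zero => simp
  | add x y hx hy => simp only [map_add, hx, hy]
  | tmul w s =>
    have : w ⊗ₜ[R] s = w ⊗ₜ 1 * 1 ⊗ₜ s := by simp
    rw [this]
    clear this
    -- The word factor has zero first derivative, so only the symmetric algebra factor remains. On a
    -- generator the first derivative is `1 ⊗ m`, and differentiating again kills the `1`.
    refine rightComm_derivation_mul (A := FreeRBSym R M) (D := rbDeriv R M) rbDeriv_mul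
      (by rw [rbDeriv_word, map_zero, map_zero]) ?_
    induction s using SymmetricAlgebra.induction with
    | algebraMap r =>
      rw [Algebra.algebraMap_eq_smul_one, tmul_smul, map_smul, rbDeriv_word]
      simp
    | ι m =>
      have h := rbDeriv_unit (R := R) m
      simp only [rbSymUnit, LinearMap.comp_apply, AlgHom.toLinearMap_apply,
        Algebra.TensorProduct.includeRight_apply] at h
      rw [h, LinearMap.rTensor_tmul, rbDeriv_one]
      simp
    | mul a b ha hb =>
      have : (1 : ShuffleAlgebra R (SymmetricAlgebra R M)) ⊗ₜ[R] (a * b) =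
          1 ⊗ₜ a * 1 ⊗ₜ b := by simp
      rw [this]
      exact rightComm_derivation_mul (A := FreeRBSym R M) (D := rbDeriv R M) rbDeriv_mul ha hb
    | add a b ha hb => simp only [tmul_add, map_add, ha, hb]

end Interchange

/-! ### Associators and braidings occurring in the Leibniz and interchange rules -/

section Symmetry

variable {R : Type u} [CommRing R] {M A : Type u} [AddCommGroup M] [Module R M]

/-- This evaluates the second summand of the Leibniz rule, where the derived factor stands on the
left and `M` has to be moved past the other one. -/
theorem tensorAct_comm_assoc [CommRing A] [Algebra R A] (z : A ⊗[R] M) (a : A) :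
    tensorAct A M ((TensorProduct.comm R M A).toLinearMap.lTensor A
      (TensorProduct.assoc R A M A (z ⊗ₜ a))) = a • z := by
  induction z using TensorProduct.induction_on with
  | zero => simp
  | add x y hx hy => simp only [add_tmul, map_add, smul_add, hx, hy]
  | tmul b m => simp [tensorAct, TensorProduct.smul_tmul', mul_comm]

theorem rightComm_eq [AddCommGroup A] [Module R A] (z : (A ⊗[R] M) ⊗[R] M) :
    TensorProduct.rightComm R A M M z = (TensorProduct.assoc R A M M).symm
      ((TensorProduct.comm R M M).toLinearMap.lTensor A (TensorProduct.assoc R A M M z)) := by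
  suffices (TensorProduct.rightComm R A M M).toLinearMap =
      (TensorProduct.assoc R A M M).symm.toLinearMap ∘ₗ
        (TensorProduct.comm R M M).toLinearMap.lTensor A ∘ₗ
          (TensorProduct.assoc R A M M).toLinearMap from congr($this z)
  ext
  simp

end Symmetry

/-! ### Compatibility of the counit `ω` with multiplication and the derivation -/

section Omega

variable {R : Type u} [CommRing R]

theorem omega_tmul_mul (A : Type u) [CommRing A] [Algebra R A]
    (x : ShuffleAlgebra R (FreeRB R A)) (y z : FreeRB R A) :
    omega R A (x ⊗ₜ (y * z)) = omega R A (x ⊗ₜ y) * z := by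
  simp [omega, mul_assoc]

/-- Since `ω (w ⊗ y)` is the product of `nest w` with `y` and `nest w` is a constant by
`rbDeriv_nest`, the Leibniz rule leaves only `nest w` times the derivative of `y`. -/
theorem rbDeriv_omega (M : Type u) [AddCommGroup M] [Module R M] :
    rbDeriv R M ∘ₗ omega R (SymmetricAlgebra R M) =
      (omega R (SymmetricAlgebra R M)).rTensor M ∘ₗ
        (TensorProduct.assoc R (ShuffleAlgebra R (FreeRB R (SymmetricAlgebra R M)))
          (FreeRB R (SymmetricAlgebra R M)) M).symm.toLinearMap ∘ₗ
        (rbDeriv R M).lTensor (ShuffleAlgebra R (FreeRB R (SymmetricAlgebra R M))) := by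
  refine TensorProduct.ext' fun w y => ?_
  have h (z : FreeRBSym R M ⊗[R] M) : (omega R (SymmetricAlgebra R M)).rTensor M
      ((TensorProduct.assoc R _ _ M).symm (w ⊗ₜ[R] z)) =
        nest (FreeRB.P R (SymmetricAlgebra R M)) FreeRB.rotaBaxter w • z := by
    induction z using TensorProduct.induction_on with
    | zero => simp
    | add x y hx hy => simp only [tmul_add, map_add, smul_add, hx, hy]
    | tmul b m => simp [TensorProduct.smul_tmul', omega]
  simp only [LinearMap.comp_apply, LinearMap.lTensor_tmul, LinearEquiv.coe_coe, h]
  simp [omega, rbDeriv_mul, rbDeriv_nest]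

end Omega

/-! ### The element `P(1)` and the functionals that detect it -/

section Coefficient

variable {R : Type u} [CommRing R] {M N : Type u} [AddCommGroup M] [Module R M]
  [AddCommGroup N] [Module R N]

variable (R M) in
/-- The augmentation `Sym(M) → R`. -/
noncomputable def symAug : SymmetricAlgebra R M →ₐ[R] R := SymmetricAlgebra.lift 0

variable (R M) in
/-- The counit `Sh(Sym(M)) ⊗ Sym(M) → R`, the coefficient of the empty word. -/
noncomputable def emptyCoeff : FreeRBSym R M →ₗ[R] R :=
  LinearMap.mul' R R ∘ₗ TensorProduct.map
    ((TensorAlgebra.algebraMapInv (R := R) (M := SymmetricAlgebra R M)).toLinearMap ∘ₗ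
      (ShuffleAlgebra.ofWord R _).symm.toLinearMap) (symAug R M).toLinearMap

variable (R M) in
/-- The coefficient of the one-letter word `1`. -/
noncomputable def letterCoeff : FreeRBSym R M →ₗ[R] R :=
  LinearMap.mul' R R ∘ₗ TensorProduct.map
    (TrivSqZeroExt.sndHom R R ∘ₗ
      (TensorAlgebra.lift R (TrivSqZeroExt.inrHom R R ∘ₗ (symAug R M).toLinearMap)).toLinearMap ∘ₗ
      (ShuffleAlgebra.ofWord R _).symm.toLinearMap) (symAug R M).toLinearMap

variable (R M) in
/-- The element `P(1)`, the one-letter word `1`. -/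
noncomputable def unitLetter : FreeRBSym R M := FreeRB.P R (SymmetricAlgebra R M) 1

theorem unitLetter_eq : unitLetter R M =
    ShuffleAlgebra.ofWord R _ (TensorAlgebra.ι R (1 : SymmetricAlgebra R M)) ⊗ₜ 1 := by
  rw [unitLetter, Algebra.TensorProduct.one_def, FreeRB.P_tmul, ← ShuffleAlgebra.ofWord_one,
    ShuffleAlgebra.snoc_apply, one_mul]

theorem one_eq : (1 : FreeRBSym R M) = ShuffleAlgebra.ofWord R _ 1 ⊗ₜ 1 := rfl

/-- The functional evaluates concatenated words in the dual numbers, each letter becoming its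
augmentation times `ε`. Longer words die as `ε² = 0`, and the letter `1` contributes exactly `ε`. -/
theorem letterCoeff_unitLetter : letterCoeff R M (unitLetter R M) = 1 := by
  simp [letterCoeff, unitLetter_eq]

theorem letterCoeff_one : letterCoeff R M 1 = 0 := by
  simp [letterCoeff, one_eq]

theorem emptyCoeff_one : emptyCoeff R M 1 = 1 := by
  simp [emptyCoeff, one_eq]

theorem unitLetter_ne_algebraMap [Nontrivial R] (r : R) :
    unitLetter R M ≠ algebraMap R (FreeRBSym R M) r := by
  intro h
  have := congrArg (letterCoeff R M) h
  rw [Algebra.algebraMap_eq_smul_one, map_smul, letterCoeff_unitLetter, letterCoeff_one,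
    smul_zero] at this
  exact one_ne_zero this

/-- Maps of Rota-Baxter algebras preserve both `1` and the operator, hence `P(1)`. This holds for
every `f`, including `f = 0`. -/
theorem rbSymMap_unitLetter (f : M →ₗ[R] N) : rbSymMap f (unitLetter R M) = unitLetter R N := by
  rw [unitLetter, rbSymMap, FreeRB.map_P, map_one]; rfl

theorem rbSymJoin_unitLetter :
    rbSymJoin R M (unitLetter R (FreeRBSym R M)) = unitLetter R M := by
  rw [unitLetter, rbSymJoin, AlgHom.comp_apply, FreeRB.map_P, counitAlgHom_P, map_one, map_one]
  rfl

end Coefficient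

/-! ### The axioms in the opposite category and the negative results -/

section Categorical

variable (R : Type u) [CommRing R]

theorem rbComonad_isCoalgebraModality :
    IsCoalgebraModality (rbComonad R) (rbComul R) (rbCounit R) where
  comul_natural {A B} f := by
    refine Quiver.Hom.unop_inj (ModuleCat.hom_ext (TensorProduct.ext'
      fun (x y : FreeRBSym R B.unop) => ?_))
    exact map_mul (rbSymMap f.unop.hom) x y
  counit_natural {A B} f := by
    refine Quiver.Hom.unop_inj (ModuleCat.hom_ext (LinearMap.ext fun r => ?_))
    exact (rbSymMap f.unop.hom).commutes r
  coassoc A := by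
    refine Quiver.Hom.unop_inj (ModuleCat.hom_ext (TensorProduct.ext (LinearMap.ext
      fun (x : FreeRBSym R A.unop) => TensorProduct.ext' fun (y z : FreeRBSym R A.unop) => ?_)))
    exact mul_assoc x y z
  counit_left A := by
    refine Quiver.Hom.unop_inj (ModuleCat.hom_ext (LinearMap.ext
      fun (x : FreeRBSym R A.unop) => ?_))
    change algebraMap R (FreeRBSym R A.unop) 1 * x = x
    rw [map_one, one_mul]
  counit_right A := by
    refine Quiver.Hom.unop_inj (ModuleCat.hom_ext (LinearMap.ext
      fun (x : FreeRBSym R A.unop) => ?_))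
    change x * algebraMap R (FreeRBSym R A.unop) 1 = x
    rw [map_one, mul_one]
  cocomm A := by
    refine Quiver.Hom.unop_inj (ModuleCat.hom_ext (TensorProduct.ext'
      fun (x y : FreeRBSym R A.unop) => ?_))
    exact mul_comm y x
  comul_delta A := by
    refine Quiver.Hom.unop_inj (ModuleCat.hom_ext (TensorProduct.ext'
      fun (x y : FreeRBSym R (FreeRBSym R A.unop)) => ?_))
    exact map_mul (rbSymJoin R A.unop) x y

theorem rbComonad_isDerivingTransformation :
    IsDerivingTransformation (rbComonad R) (rbComul R) (rbCounit R) (rbDerivOp R) where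
  natural {A B} f := by
    refine Quiver.Hom.unop_inj (ModuleCat.hom_ext ?_)
    exact (rbDeriv_natural f.unop.hom).symm
  constant_rule A := by
    refine Quiver.Hom.unop_inj (ModuleCat.hom_ext (LinearMap.ext fun r => ?_))
    change rbDeriv R A.unop (algebraMap R _ r) = 0
    rw [Algebra.algebraMap_eq_smul_one, map_smul, rbDeriv_one, smul_zero]
  leibniz_rule A := by
    refine Quiver.Hom.unop_inj (ModuleCat.hom_ext (TensorProduct.ext'
      fun (x y : FreeRBSym R A.unop) => ?_))
    refine (rbDeriv_mul x y).trans ?_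
    -- In `MOD_R` the composite is read backwards: differentiate one factor, move `M` to the right,
    -- then multiply the two algebra factors.
    change _ = tensorAct (FreeRBSym R A.unop) A.unop (x ⊗ₜ rbDeriv R A.unop y +
      (TensorProduct.comm R A.unop (FreeRBSym R A.unop)).toLinearMap.lTensor (FreeRBSym R A.unop)
        (TensorProduct.assoc R _ _ _ (rbDeriv R A.unop x ⊗ₜ y)))
    rw [map_add, tensorAct_tmul, tensorAct_comm_assoc]
  linear_rule A := by
    refine Quiver.Hom.unop_inj (ModuleCat.hom_ext (LinearMap.ext fun m => ?_))
    refine (rbDeriv_unit m).trans ?_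
    change _ = algebraMap R (FreeRBSym R A.unop) 1 ⊗ₜ m
    rw [map_one]
  chain_rule A := by
    refine Quiver.Hom.unop_inj (ModuleCat.hom_ext ?_)
    exact rbDeriv_chain
  interchange_rule A := by
    refine Quiver.Hom.unop_inj (ModuleCat.hom_ext (LinearMap.ext
      fun (x : FreeRBSym R A.unop) => ?_))
    refine (rbDeriv_interchange x).symm.trans ?_
    rw [rightComm_eq]
    rfl

theorem not_isMonoidalCoalgebraModality [Nontrivial R] :
    ¬ ∃ m mK, IsMonoidalCoalgebraModality (rbComonad R) (rbComul R) (rbCounit R) m mK := by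
  rintro ⟨m, mK, h⟩
  let A : (ModuleCat.{u} R)ᵒᵖ := Opposite.op (ModuleCat.of R R)
  -- In `MOD_R` this axiom says that the join after `T` of the algebra unit factors through the
  -- scalars. Both maps preserve `P(1)`, which would thus be a scalar.
  have h1 := congrArg (fun f => f.unop.hom (unitLetter R R)) (h.counit_coalg A)
  have h2 : rbSymJoin R R (rbSymMap (Algebra.linearMap R (FreeRBSym R R)) (unitLetter R R)) =
      algebraMap R (FreeRBSym R R) (mK.unop.hom (unitLetter R R)) := h1
  rw [rbSymMap_unitLetter, rbSymJoin_unitLetter] at h2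
  exact unitLetter_ne_algebraMap _ h2

theorem not_isAdditiveBialgebraModality [Nontrivial R] :
    ¬ ∃ mul u,
      IsAdditiveBialgebraModality (rbComonad R) (rbComul R) (rbCounit R) mul u := by
  rintro ⟨mul, u, h⟩
  let A : (ModuleCat.{u} R)ᵒᵖ := Opposite.op (ModuleCat.of R R)
  -- Additivity makes `T(0)` factor through the scalars, although it fixes `P(1)`.
  have h1 := congrArg (fun f => f.unop.hom (unitLetter R R)) (h.map_zero A A)
  have h2 : rbSymMap (0 : R →ₗ[R] R) (unitLetter R R) =
      algebraMap R (FreeRBSym R R) ((u A).unop.hom (unitLetter R R)) := h1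
  rw [rbSymMap_unitLetter] at h2
  exact unitLetter_ne_algebraMap _ h2

/-- Surjectivity of the algebra unit fails at `P(1)` for every module, in particular for the zero
module. -/
theorem not_isIso_rbCounit [Nontrivial R] (A : (ModuleCat.{u} R)ᵒᵖ) :
    ¬ IsIso (rbCounit R A) := by
  intro h
  have h1 : IsIso (rbCounit R A).unop := inferInstance
  obtain ⟨r, hr⟩ := ((ConcreteCategory.isIso_iff_bijective _).mp h1).2 (unitLetter R A.unop)
  exact unitLetter_ne_algebraMap r hr.symm

theorem not_isIso_seelyMap [Nontrivial R] (A B : (ModuleCat.{u} R)ᵒᵖ) :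
    ¬ IsIso (seelyMap (rbComonad R) (rbComul R) A B) := by
  intro h
  have h1 : IsIso (seelyMap (rbComonad R) (rbComul R) A B).unop := inferInstance
  have h2 := ((ConcreteCategory.isIso_iff_bijective _).mp h1).1
  let x : FreeRBSym R A.unop ⊗[R] FreeRBSym R B.unop := unitLetter R A.unop ⊗ₜ 1
  let y : FreeRBSym R A.unop ⊗[R] FreeRBSym R B.unop := 1 ⊗ₜ unitLetter R B.unop
  -- Injectivity is what fails: both elements are sent to `P(1)` in `T(M ⊕ N)`.
  have hxy : x = y := by
    refine h2 ?_
    change rbSymMap (Limits.prod.fst (X := A) (Y := B)).unop.hom (unitLetter R A.unop) *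
        rbSymMap (Limits.prod.snd (X := A) (Y := B)).unop.hom 1 =
      rbSymMap (Limits.prod.fst (X := A) (Y := B)).unop.hom 1 *
        rbSymMap (Limits.prod.snd (X := A) (Y := B)).unop.hom (unitLetter R B.unop)
    rw [rbSymMap_unitLetter, rbSymMap_unitLetter, map_one, map_one, mul_one, one_mul]
  -- This functional takes the value `1` on `x` and `0` on `y`, the latter because `letterCoeff`
  -- vanishes at `1`.
  have := congrArg (LinearMap.mul' R R ∘ₗ
    TensorProduct.map (letterCoeff R A.unop) (emptyCoeff R B.unop)) hxy
  simp [x, y, letterCoeff_unitLetter, letterCoeff_one, emptyCoeff_one] at this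

end Categorical

end RotaBaxter

theorem mainTheorem10 (R : Type u) [CommRing R] :
    IsCoalgebraModality (rbComonad R) (rbComul R) (rbCounit R) ∧
    IsDerivingTransformation (rbComonad R) (rbComul R) (rbCounit R) (rbDerivOp R) ∧
    (∀ (A : Type u) [CommRing A] [Algebra R A] (x : ShuffleAlgebra R (FreeRB R A))
      (y z : FreeRB R A), omega R A (x ⊗ₜ (y * z)) = omega R A (x ⊗ₜ y) * z) ∧
    (∀ (M : Type u) [AddCommGroup M] [Module R M],
      rbDeriv R M ∘ₗ omega R (SymmetricAlgebra R M) =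
        (omega R (SymmetricAlgebra R M)).rTensor M ∘ₗ
          (TensorProduct.assoc R (ShuffleAlgebra R (FreeRB R (SymmetricAlgebra R M)))
            (FreeRB R (SymmetricAlgebra R M)) M).symm.toLinearMap ∘ₗ
          (rbDeriv R M).lTensor (ShuffleAlgebra R (FreeRB R (SymmetricAlgebra R M)))) ∧
    (Nontrivial R →
      (¬ ∃ m mK, IsMonoidalCoalgebraModality (rbComonad R) (rbComul R) (rbCounit R) m mK) ∧
      (¬ ∃ mul u, IsAdditiveBialgebraModality (rbComonad R) (rbComul R) (rbCounit R) mul u) ∧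
      ¬ IsIso (rbCounit R (⊤_ (ModuleCat.{u} R)ᵒᵖ)) ∧
      ∀ A B : (ModuleCat.{u} R)ᵒᵖ, ¬ IsIso (seelyMap (rbComonad R) (rbComul R) A B)) :=
  ⟨rbComonad_isCoalgebraModality R, rbComonad_isDerivingTransformation R,
    fun A _ _ x y z => omega_tmul_mul A x y z, fun M _ _ => rbDeriv_omega M,
    fun _ => ⟨not_isMonoidalCoalgebraModality R, not_isAdditiveBialgebraModality R,
      not_isIso_rbCounit R _, not_isIso_seelyMap R⟩⟩
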